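/- Let $S$ be a finite set and let $I$ be a set of positive real numbers having $0$ as a limit point. A perturbation on $S$ is a family $(p_\epsilon)_{\epsilon\in I}$ of transition matrices of (time-homogeneous, discrete-time) Markov chains with state space $S$. A state $x\in S$ is called stochastically stable if there is a family $(\mu_\epsilon)_{\epsilon\in I}$, with $\mu_\epsilon$ a stationary distribution of $p_\epsilon$ for every $\epsilon \in I$, such that $\liminf_{\epsilon\to 0}\mu_\epsilon(x)>0$; it is called fully vanishing if $\limsup_{\epsilon\to 0}\mu_\epsilon(x)=0$ for every such family $(\mu_\epsilon)_{\epsilon\in I}$. For $f,g:I\to[0,1]$ write $f\precsim g$ if there are $b>0$ and $\epsilon>0$ such that $f(\epsilon')\le b\,g(\epsilon')$ for all $\epsilon'\in I$ with $\epsilon'<\epsilon$, and write $f\cong g$ if $f\precsim g$ and $g\precsim f$; $f \in o(g)$ is meant as $\epsilon\to 0$ in $I$. Assume that 1. for all $x\neq y$ in $S$, if the map $\epsilon\mapsto p_\epsilon(x,y)$ is not identically zero on $I$, then $p_\epsilon(x,y)>0$ for all $\epsilon\in I$; and 2. for all $f,g$ in the multiplicative closure of the maps $\epsilon\mapsto p_\epsilon(x,y)$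 with $x\neq y$ (that is, the set of all products of one or more of these maps), $f\cong g$ or $f\in o(g)$ or $g\in o(f)$. Then every state $x\in S$ is either stochastically stable or fully vanishing (and not both). -/

import Mathlib

open Filter Topology Asymptotics

/-- A (Markov chain) perturbation on the finite state space `S`: a family of time-homogeneous
discrete-time Markov chains on `S`, given by their transition matrices `p ε`, where `ε` ranges over
a set `I` of positive real numbers that has `0` as a limit point. -/
structure Perturbation (S : Type*) [Fintype S] [DecidableEq S] where
  /-- the set of parameters -/
  I : Set ℝ
  I_pos : ∀ ε ∈ I, 0 < ε
  zero_limitPoint : AccPt (0 : ℝ) (𝓟 I)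
  /-- the transition matrix of the chain with parameter `ε` -/
  p : I → Matrix S S ℝ
  stochastic : ∀ ε, p ε ∈ Matrix.rowStochastic ℝ S

/-- The filter "`ε` tends to `0` inside `I`", on the subtype `I`. -/
def towardsZero (I : Set ℝ) : Filter I := comap (fun ε : I => (ε : ℝ)) (𝓝 0)

/-- `f ≾ g`: there are positive `b` and `ε` such that `f ε' ≤ b * g ε'` for all `ε' ∈ I` with
`ε' < ε`. -/
def AsympLE {I : Set ℝ} (f g : I → ℝ) : Prop :=
  ∃ b > 0, ∃ ε > 0, ∀ ε' : I, (ε' : ℝ) < ε → f ε' ≤ b * g ε'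

/-- `f ≅ g`: `f ≾ g` and `g ≾ f`. -/
def AsympEquiv {I : Set ℝ} (f g : I → ℝ) : Prop := AsympLE f g ∧ AsympLE g f

/-- `μ` is a stationary distribution of the Markov chain with transition matrix `P`. -/
def IsStationaryDistribution {S : Type*} [Fintype S] (P : Matrix S S ℝ) (μ : S → ℝ) : Prop :=
  μ ∈ stdSimplex ℝ S ∧ Matrix.vecMul μ P = μ

namespace Perturbation

variable {S : Type*} [Fintype S] [DecidableEq S]

/-- The transition probability map `ε ↦ p_ε(x, y)`. -/
def trans (X : Perturbation S) (x y : S) : X.I → ℝ := fun ε => X.p ε x y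

/-- A choice of a stationary distribution `μ ε` for every `ε ∈ I`. -/
def IsStationaryMap (X : Perturbation S) (μ : X.I → S → ℝ) : Prop :=
  ∀ ε, IsStationaryDistribution (X.p ε) (μ ε)

/-- `x` is stochastically stable. -/
def IsStable (X : Perturbation S) (x : S) : Prop :=
  ∃ μ : X.I → S → ℝ, X.IsStationaryMap μ ∧ 0 < liminf (fun ε => μ ε x) (towardsZero X.I)

/-- `x` is (stochastically) fully vanishing. -/
def IsFullyVanishing (X : Perturbation S) (x : S) : Prop :=
  ∀ μ : X.I → S → ℝ, X.IsStationaryMap μ → limsup (fun ε => μ ε x) (towardsZero X.I) = 0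

/-- The multiplicative closure of the maps `ε ↦ p_ε(x, y)` with `x ≠ y`: the set of all products of
one or more of these maps. -/
def multClosure (X : Perturbation S) : Subsemigroup (X.I → ℝ) :=
  Subsemigroup.closure {f | ∃ x y : S, x ≠ y ∧ f = X.trans x y}

/-- Every off-diagonal transition probability map that is not identically zero is positive
everywhere, and any two elements of the multiplicative closure are related by `≅`, by `o`, or by
the reverse `o`, as `ε → 0`. -/
def StrongAssumption (X : Perturbation S) : Prop :=
  (∀ x y : S, x ≠ y → X.trans x y ≠ 0 → ∀ ε, 0 < X.trans x y ε) ∧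
    ∀ f ∈ X.multClosure, ∀ g ∈ X.multClosure,
      AsympEquiv f g ∨ f =o[towardsZero X.I] g ∨ g =o[towardsZero X.I] f

end Perturbation

/-! Let `C` be the least closed set containing `x`; by positivity it is the same for every `ε`. If
some nonempty closed part of `C` avoids `x`, then `x` is transient and has mass zero under every
stationary distribution (`apply_eq_zero_of_closed`). Otherwise the balance equations on `C` have a
solution `W` to which all others are proportional (`exists_balancedOn`). Eliminating the states
other than `x` one by one yields `W` from off-diagonal rates by sums and products alone. A sum of
positive functions has the order of its largest term, so each `W y` is zero or has the order of a
product of transition maps (`IsMonomialOrder.add`), and nonzero entries are comparable. If `W x`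
dominates, normalizing `W` makes `x` stable; if `W x = o(W y)`, proportionality forces the mass of
`x` to tend to zero. -/

/-! ### Division-free elimination of states -/

section Elimination

variable {S R : Type*} [CommRing R]

/-- The weights `ν` satisfy the balance equations of the rates `q` on the set `K`. -/
def BalancedOn (K : Finset S) (q : S → S → R) (ν : S → R) : Prop :=
  ∀ y ∈ K, ∑ u ∈ K, ν u * q u y = ν y * ∑ v ∈ K, q y v

/-- The rates after elimination of the state `z`, up to the common factor `∑ w ∈ K, q z w`. -/
def eliminate (K : Finset S) (q : S → S → R) (z u v : S) : R :=
  q u v * (∑ w ∈ K, q z w) + q u z * q z v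

theorem sum_mul_eliminate_left (K : Finset S) (q : S → S → R) (z y : S) (ν : S → R) :
    ∑ u ∈ K, ν u * eliminate K q z u y =
      (∑ w ∈ K, q z w) * (∑ u ∈ K, ν u * q u y) + q z y * ∑ u ∈ K, ν u * q u z := by
  rw [Finset.mul_sum (f := fun u => ν u * q u y), Finset.mul_sum (f := fun u => ν u * q u z),
    ← Finset.sum_add_distrib]
  refine Finset.sum_congr rfl fun u _ => ?_
  unfold eliminate
  ring

theorem sum_eliminate_right (K : Finset S) (q : S → S → R) (z y : S) :
    ∑ v ∈ K, eliminate K q z y v =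
      (∑ w ∈ K, q z w) * ((∑ v ∈ K, q y v) + q y z) := by
  simp only [eliminate, Finset.sum_add_distrib, ← Finset.sum_mul, ← Finset.mul_sum]
  ring

/-- Here and below `P` is an abstract positivity, later `IsMonomialOrder`. Zero is kept apart
because transitions may be absent. -/
theorem sum_zero_or_pos {P : R → Prop} (hadd : ∀ f g, P f → P g → P (f + g))
    (K : Finset S) (f : S → R) (hf : ∀ u ∈ K, f u = 0 ∨ P (f u)) :
    ∑ u ∈ K, f u = 0 ∨ P (∑ u ∈ K, f u) := by
  refine Finset.sum_induction f (fun f => f = 0 ∨ P f) ?_ (Or.inl rfl) hf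
  rintro a b (rfl | ha) (rfl | hb)
  · simp
  · simpa using Or.inr hb
  · simpa using Or.inr ha
  · exact Or.inr (hadd _ _ ha hb)

theorem mul_zero_or_pos {P : R → Prop} (hmul : ∀ f g, P f → P g → P (f * g)) {a b : R}
    (ha : a = 0 ∨ P a) (hb : b = 0 ∨ P b) : a * b = 0 ∨ P (a * b) := by
  rcases ha with rfl | ha
  · simp
  rcases hb with rfl | hb
  · simp
  exact Or.inr (hmul _ _ ha hb)

theorem add_zero_or_pos {P : R → Prop} (hadd : ∀ f g, P f → P g → P (f + g)) {a b : R}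
    (ha : a = 0 ∨ P a) (hb : b = 0 ∨ P b) : a + b = 0 ∨ P (a + b) := by
  rcases ha with rfl | ha
  · simpa using hb
  rcases hb with rfl | hb
  · simpa using Or.inr ha
  exact Or.inr (hadd _ _ ha hb)

theorem add_pos_of_zero_or_pos {P : R → Prop} (hadd : ∀ f g, P f → P g → P (f + g)) {a b : R}
    (ha : a = 0 ∨ P a) (hb : P b) : P (a + b) := by
  rcases ha with rfl | ha
  · simpa using hb
  exact hadd _ _ ha hb

theorem add_pos_zero_or_pos {P : R → Prop} (hadd : ∀ f g, P f → P g → P (f + g)) {a b : R}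
    (ha : P a) (hb : b = 0 ∨ P b) : P (a + b) := by
  rw [add_comm]
  exact add_pos_of_zero_or_pos hadd hb ha

variable [DecidableEq S]

theorem balancedOn_insert_iff {K : Finset S} {z : S} (hz : z ∉ K) (q : S → S → R) (ν : S → R) :
    BalancedOn (insert z K) q ν ↔
      (∑ u ∈ K, ν u * q u z = ν z * ∑ v ∈ K, q z v) ∧
      ∀ y ∈ K, ν z * q z y + ∑ u ∈ K, ν u * q u y = ν y * (q y z + ∑ v ∈ K, q y v) := by
  simp only [BalancedOn, Finset.forall_mem_insert, Finset.sum_insert hz, mul_add, add_right_inj]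

/-- Multiply the equation at `y` by the exit rate of `z`, then use the equation at `z` to replace `ν
z` times that rate by the inflow into `z`. -/
theorem BalancedOn.eliminate {K : Finset S} {z : S} (hz : z ∉ K) {q : S → S → R} {ν : S → R}
    (h : BalancedOn (insert z K) q ν) : BalancedOn K (eliminate K q z) ν := by
  obtain ⟨h1, h2⟩ := (balancedOn_insert_iff hz q ν).1 h
  intro y hy
  rw [sum_mul_eliminate_left, sum_eliminate_right, h1]
  linear_combination (∑ w ∈ K, q z w) * h2 y hy

theorem sum_pos_of_exists {P : R → Prop} (hadd : ∀ f g, P f → P g → P (f + g))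
    (K : Finset S) (f : S → R) (hf : ∀ u ∈ K, f u = 0 ∨ P (f u)) {v : S} (hv : v ∈ K)
    (hPv : P (f v)) : P (∑ u ∈ K, f u) := by
  rw [← Finset.add_sum_erase K f hv]
  rcases sum_zero_or_pos hadd (K.erase v) f fun u hu => hf u (Finset.mem_of_mem_erase hu) with h | h
  · simpa [h] using hPv
  · exact hadd _ _ hPv h

/-- If no nonempty subset of `T` is closed for the rates `q` on `insert x T`, then the balance
equations have a solution obtained from the rates by sums and products only, positive at `x`,
to which every other solution is proportional. -/
theorem exists_balancedOn {P : R → Prop} (hadd : ∀ f g, P f → P g → P (f + g))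
    (hmul : ∀ f g, P f → P g → P (f * g)) {a : R} (ha : P a) (x : S) (T : Finset S)
    (hxT : x ∉ T) (q : S → S → R) (hq : ∀ u v, q u v = 0 ∨ P (q u v))
    (hT : ∀ U ⊆ T, U.Nonempty → ∃ u ∈ U, ∃ v ∈ insert x T, v ∉ U ∧ P (q u v)) :
    ∃ W : S → R, BalancedOn (insert x T) q W ∧ P (W x) ∧ (∀ y, W y = 0 ∨ P (W y)) ∧
      ∀ ν, BalancedOn (insert x T) q ν →
        ∀ u ∈ insert x T, ∀ v ∈ insert x T, ν u * W v = ν v * W u := by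
  induction T using Finset.induction_on generalizing q with
  | empty =>
    -- `a` replaces `1`, for which `P` is not assumed.
    refine ⟨fun _ => a, by simp [BalancedOn], ha, fun _ => Or.inr ha, ?_⟩
    intro ν _ u hu v hv
    simp only [insert_empty_eq, Finset.mem_singleton] at hu hv
    rw [hu, hv]
  | insert z T hzT ih =>
    have hxz : x ≠ z := fun h => hxT (by simp [h])
    have hxT' : x ∉ T := fun h => hxT (by simp [h])
    rw [Finset.insert_comm x z T] at hT ⊢
    set K := insert x T with hK
    have hzK : z ∉ K := by simp [hK, hzT, hxz.symm]
    have hs : P (∑ w ∈ K, q z w) := by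
      obtain ⟨u, hu, v, hv, hvu, hp⟩ := hT {z} (by simp) (by simp)
      obtain rfl : u = z := by simpa using hu
      have hvK : v ∈ K := by
        rcases Finset.mem_insert.1 hv with h | h
        · exact absurd h (by simpa using hvu)
        · exact h
      exact sum_pos_of_exists hadd K _ (fun w _ => hq u w) hvK hp
    obtain ⟨W, hW, hWx, hWP, hWu⟩ := ih hxT' (eliminate K q z)
      (fun u v => add_zero_or_pos hadd (mul_zero_or_pos hmul (hq u v) (Or.inr hs))
        (mul_zero_or_pos hmul (hq u z) (hq z v)))
      (by
        intro U hU hne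
        have step1 : ∀ u v, P (q u v) → P (eliminate K q z u v) := fun u v h =>
          add_pos_zero_or_pos hadd (hmul _ _ h hs) (mul_zero_or_pos hmul (hq u z) (hq z v))
        obtain ⟨u, hu, v, hv, hvU, hp⟩ := hT U (hU.trans (Finset.subset_insert _ _)) hne
        rcases Finset.mem_insert.1 hv with rfl | hv
        -- If `U` exits to the eliminated state, an exit from that state together with `U` gives
        -- either a two-step path or a direct exit.
        · obtain ⟨u', hu', v', hv', hvU', hp'⟩ := hT (insert v U)
            (Finset.insert_subset_insert _ hU) (Finset.insert_nonempty _ _)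
          rw [Finset.mem_insert, not_or] at hvU'
          have hv'K : v' ∈ K := (Finset.mem_insert.1 hv').resolve_left hvU'.1
          rcases Finset.mem_insert.1 hu' with rfl | hu'
          · exact ⟨u, hu, v', hv'K, hvU'.2, add_pos_of_zero_or_pos hadd
              (mul_zero_or_pos hmul (hq u v') (Or.inr hs)) (hmul _ _ hp hp')⟩
          · exact ⟨u', hu', v', hv'K, hvU'.2, step1 _ _ hp'⟩
        · exact ⟨u, hu, v, hv, hvU, step1 _ _ hp⟩)
    set s := ∑ w ∈ K, q z w with hsdef
    have hWz : (∑ u ∈ K, W u * q u z) = 0 ∨ P (∑ u ∈ K, W u * q u z) :=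
      sum_zero_or_pos hadd K _ fun u _ => mul_zero_or_pos hmul (hWP u) (hq u z)
    have hne : ∀ u ∈ K, u ≠ z := fun u hu h => hzK (h ▸ hu)
    -- Scaling by the exit rate `s` avoids dividing the inflow into `z` by it.
    refine ⟨fun y => if y = z then ∑ u ∈ K, W u * q u z else s * W y, ?_, ?_, ?_, ?_⟩
    · have key : ∀ y, ∑ u ∈ K, (if u = z then ∑ u ∈ K, W u * q u z else s * W u) * q u y =
          s * ∑ u ∈ K, W u * q u y := by
        intro y
        rw [Finset.mul_sum]
        refine Finset.sum_congr rfl fun u hu => ?_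
        rw [if_neg (hne u hu), mul_assoc]
      rw [balancedOn_insert_iff hzK]
      refine ⟨?_, fun y hy => ?_⟩
      · rw [key, if_pos rfl, ← hsdef, mul_comm]
      · have hWy := hW y hy
        rw [sum_mul_eliminate_left, sum_eliminate_right, ← hsdef] at hWy
        rw [key, if_pos rfl, if_neg (hne y hy)]
        linear_combination hWy
    · dsimp only
      rw [if_neg hxz]
      exact hmul _ _ hs hWx
    · intro y
      dsimp only
      split_ifs
      · exact hWz
      · exact mul_zero_or_pos hmul (Or.inr hs) (hWP y)
    · intro ν hν
      have hνu := hWu ν (hν.eliminate hzK)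
      have hνz := ((balancedOn_insert_iff hzK q ν).1 hν).1
      have hz : ∀ v ∈ K, ν z * (s * W v) = ν v * ∑ u ∈ K, W u * q u z := by
        intro v hv
        rw [← mul_assoc, ← hνz, Finset.sum_mul, Finset.mul_sum]
        refine Finset.sum_congr rfl fun u hu => ?_
        linear_combination q u z * hνu u hu v hv
      intro u hu v hv
      rcases Finset.mem_insert.1 hu with hu' | hu' <;> rcases Finset.mem_insert.1 hv with hv' | hv'
      · rw [hu', hv']
      · simpa [hu', hne v hv'] using hz v hv'
      · simpa [hv', hne u hu'] using (hz u hu').symm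
      · simp only [hne u hu', hne v hv', if_false]
        linear_combination s * hνu u hu' v hv'

/-- The balance equations do not involve the diagonal rates. -/
theorem balancedOn_offDiag {R : Type*} [CommRing R] (K : Finset S) (q : S → S → R) (ν : S → R) :
    BalancedOn K (fun u v => if u = v then 0 else q u v) ν ↔ BalancedOn K q ν := by
  refine forall₂_congr fun y hy => ?_
  rw [← Finset.add_sum_erase K _ hy, ← Finset.add_sum_erase K (fun v => if y = v then 0 else q y v)
    hy, ← Finset.add_sum_erase K (fun u => ν u * q u y) hy, ← Finset.add_sum_erase K (q y) hy,
    mul_add (ν y) (q y y), add_right_inj]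
  have h1 : ∑ u ∈ K.erase y, ν u * (if u = y then 0 else q u y) = ∑ u ∈ K.erase y, ν u * q u y :=
    Finset.sum_congr rfl fun u hu => by rw [if_neg (Finset.ne_of_mem_erase hu)]
  have h2 : ∑ v ∈ K.erase y, (if y = v then 0 else q y v) = ∑ v ∈ K.erase y, q y v :=
    Finset.sum_congr rfl fun v hv => by rw [if_neg (Finset.ne_of_mem_erase hv).symm]
  rw [h1, h2]
  simp

end Elimination

/-! ### Stationary distributions and closed sets -/

section Stationary

variable {S : Type*} [Fintype S] [DecidableEq S]

/-- No mass flows into a closed set of states under a stationary distribution. -/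
theorem inflow_eq_zero {P : Matrix S S ℝ} (hP : P ∈ Matrix.rowStochastic ℝ S) {ν : S → ℝ}
    (hν : IsStationaryDistribution P ν) {U : Finset S}
    (hU : ∀ u ∈ U, ∀ v ∉ U, P u v = 0) : ∀ u ∉ U, ∀ v ∈ U, ν u * P u v = 0 := by
  have hnn : ∀ u v, 0 ≤ ν u * P u v := fun u v =>
    mul_nonneg (hν.1.1 u) (Matrix.nonneg_of_mem_rowStochastic hP)
  have hstat : ∀ y, ∑ u, ν u * P u y = ν y := fun y => by
    simpa [Matrix.vecMul, dotProduct] using congrFun hν.2 y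
  have hrow : ∀ u ∈ U, ∑ v ∈ U, ν u * P u v = ν u := by
    intro u hu
    rw [← Finset.mul_sum, Finset.sum_subset (Finset.subset_univ U) fun v _ hv => hU u hu v hv,
      Matrix.sum_row_of_mem_rowStochastic hP, mul_one]
  -- The mass of `U` is its total inflow by stationarity, and its inflow from `U` alone by
  -- closedness.
  have hsum : ∑ v ∈ U, ∑ u ∈ Uᶜ, ν u * P u v = 0 := by
    have h1 : ∑ v ∈ U, ∑ u, ν u * P u v = ∑ v ∈ U, ν v := Finset.sum_congr rfl fun v _ => hstat v
    have h2 : ∑ v ∈ U, ∑ u ∈ U, ν u * P u v = ∑ v ∈ U, ν v := by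
      rw [Finset.sum_comm]
      exact Finset.sum_congr rfl hrow
    simp only [← Finset.sum_add_sum_compl U, Finset.sum_add_distrib] at h1
    linarith
  intro u hu v hv
  rw [Finset.sum_eq_zero_iff_of_nonneg fun v _ => Finset.sum_nonneg fun u _ => hnn u v] at hsum
  have := hsum v hv
  rw [Finset.sum_eq_zero_iff_of_nonneg fun u _ => hnn u v] at this
  exact this u (by simpa using hu)

/-- A state from which one can enter, without return, a closed set is null. -/
theorem apply_eq_zero_of_closed {P : Matrix S S ℝ} (hP : P ∈ Matrix.rowStochastic ℝ S)
    {ν : S → ℝ} (hν : IsStationaryDistribution P ν) {U : Finset S}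
    (hU : ∀ u ∈ U, ∀ v ∉ U, P u v = 0) (hne : U.Nonempty) {x : S} (hx : x ∉ U)
    (hC : ∀ Z : Finset S, x ∈ Z → (∀ u ∈ Z, ∀ v ∉ Z, P u v = 0) → U ⊆ Z) : ν x = 0 := by
  by_contra hνx
  -- The charged states outside `U` form a closed set: a charged state leads neither to a null state
  -- nor, by `inflow_eq_zero`, into `U`.
  have hsub := hC (Finset.univ.filter fun v => ν v ≠ 0 ∧ v ∉ U) (by simp [hνx, hx]) (by
    simp only [Finset.mem_filter, Finset.mem_univ, true_and, not_and, not_not]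
    rintro u ⟨hu, huU⟩ v hv
    by_cases hv0 : ν v = 0
    · have hstat : ∑ u, ν u * P u v = 0 := by
        simpa [Matrix.vecMul, dotProduct, hv0] using congrFun hν.2 v
      rw [Finset.sum_eq_zero_iff_of_nonneg fun u _ => mul_nonneg (hν.1.1 u)
        (Matrix.nonneg_of_mem_rowStochastic hP)] at hstat
      exact (mul_eq_zero.1 (hstat u (Finset.mem_univ u))).resolve_left hu
    · exact (mul_eq_zero.1 (inflow_eq_zero hP hν hU u huU v (hv hv0))).resolve_left hu)
  obtain ⟨u, hu⟩ := hne
  have := hsub hu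
  simp only [Finset.mem_filter] at this
  exact this.2.2 hu

/-- A stationary distribution restricts to a balanced weight on a closed set. -/
theorem balancedOn_of_isStationary {P : Matrix S S ℝ} (hP : P ∈ Matrix.rowStochastic ℝ S)
    {ν : S → ℝ} (hν : IsStationaryDistribution P ν) {U : Finset S}
    (hU : ∀ u ∈ U, ∀ v ∉ U, P u v = 0) : BalancedOn U P ν := by
  intro y hy
  have hstat : ∑ u, ν u * P u y = ν y := by
    simpa [Matrix.vecMul, dotProduct] using congrFun hν.2 y
  rw [Finset.sum_subset (Finset.subset_univ U) fun u _ hu => inflow_eq_zero hP hν hU u hu y hy,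
    hstat, Finset.sum_subset (Finset.subset_univ U) fun v _ hv => hU y hy v hv,
    Matrix.sum_row_of_mem_rowStochastic hP, mul_one]

/-- Normalizing a nonnegative balanced weight on a closed set gives a stationary distribution. -/
theorem isStationary_of_balancedOn {P : Matrix S S ℝ} (hP : P ∈ Matrix.rowStochastic ℝ S)
    {U : Finset S} (hU : ∀ u ∈ U, ∀ v ∉ U, P u v = 0) {W : S → ℝ} (hW : BalancedOn U P W)
    (hnn : ∀ u, 0 ≤ W u) (hpos : 0 < ∑ u ∈ U, W u) :
    IsStationaryDistribution P fun y => if y ∈ U then W y / ∑ u ∈ U, W u else 0 := by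
  refine ⟨⟨fun y => ?_, ?_⟩, ?_⟩
  · dsimp only
    split_ifs
    · exact div_nonneg (hnn y) hpos.le
    · exact le_rfl
  · rw [← Finset.sum_filter, Finset.filter_mem_eq_inter, Finset.univ_inter, ← Finset.sum_div,
      div_self hpos.ne']
  · funext y
    have h1 : Matrix.vecMul (fun y => if y ∈ U then W y / ∑ u ∈ U, W u else 0) P y =
        (∑ u ∈ U, W u * P u y) / ∑ u ∈ U, W u := by
      simp only [Matrix.vecMul, dotProduct, ite_mul, zero_mul]
      rw [← Finset.sum_filter, Finset.filter_mem_eq_inter, Finset.univ_inter, Finset.sum_div]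
      exact Finset.sum_congr rfl fun u _ => by ring
    rw [h1]
    split_ifs with hy
    · rw [hW y hy, Finset.sum_subset (Finset.subset_univ U) fun v _ hv => hU y hy v hv,
        Matrix.sum_row_of_mem_rowStochastic hP, mul_one]
    · rw [Finset.sum_eq_zero fun u hu => by rw [hU u hu y hy, mul_zero], zero_div]

end Stationary

/-! ### Orders of magnitude and the dichotomy -/

section Asymptotic

theorem towardsZero_neBot {I : Set ℝ} (h : AccPt (0 : ℝ) (𝓟 I)) : (towardsZero I).NeBot := by
  refine comap_neBot fun t ht => ?_
  obtain ⟨y, hy, -⟩ := accPt_iff_nhds.1 h t ht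
  exact ⟨⟨y, hy.2⟩, hy.1⟩

theorem AsympLE.isBigO {I : Set ℝ} {f g : I → ℝ} (h : AsympLE f g) (hf : ∀ ε, 0 ≤ f ε) :
    f =O[towardsZero I] g := by
  obtain ⟨b, hb, δ, hδ, h⟩ := h
  refine IsBigO.of_bound b ?_
  have : ∀ᶠ ε : I in towardsZero I, (ε : ℝ) < δ :=
    tendsto_comap.eventually (gt_mem_nhds hδ)
  filter_upwards [this] with ε hε
  rw [Real.norm_of_nonneg (hf ε)]
  exact (h ε hε).trans (mul_le_mul_of_nonneg_left (le_abs_self _) hb.le)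

/-- Nonnegativity excludes cancellation. -/
theorem isTheta_add_of_isBigO {α : Type*} {l : Filter α} {f g h : α → ℝ} (hf : ∀ a, 0 ≤ f a)
    (hg : ∀ a, 0 ≤ g a) (hgh : g =Θ[l] h) (hfh : f =O[l] h) : (f + g) =Θ[l] h := by
  refine ⟨hfh.add hgh.1, hgh.2.trans (IsBigO.of_norm_le fun a => ?_)⟩
  rw [Real.norm_of_nonneg (hg a), Pi.add_apply]
  linarith [hf a]

namespace Perturbation

variable {S : Type*} [Fintype S] [DecidableEq S]

/-- The function `f` is positive and of the same order of magnitude as a product of transition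
probability maps. -/
def IsMonomialOrder (X : Perturbation S) (f : X.I → ℝ) : Prop :=
  (∀ ε, 0 < f ε) ∧ ∃ g ∈ X.multClosure, (∀ ε, 0 < g ε) ∧ f =Θ[towardsZero X.I] g

variable {X : Perturbation S}

theorem StrongAssumption.isBigO_or (hX : X.StrongAssumption) {f g : X.I → ℝ}
    (hf : f ∈ X.multClosure) (hg : g ∈ X.multClosure) (hf0 : ∀ ε, 0 < f ε) :
    f =O[towardsZero X.I] g ∨ g =o[towardsZero X.I] f := by
  rcases hX.2 f hf g hg with h | h | h
  · exact Or.inl (h.1.isBigO fun ε => (hf0 ε).le)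
  · exact Or.inl h.isBigO
  · exact Or.inr h

theorem IsMonomialOrder.mul {f g : X.I → ℝ} (hf : X.IsMonomialOrder f)
    (hg : X.IsMonomialOrder g) : X.IsMonomialOrder (f * g) := by
  obtain ⟨hf0, a, ha, ha0, hfa⟩ := hf
  obtain ⟨hg0, b, hb, hb0, hgb⟩ := hg
  exact ⟨fun ε => mul_pos (hf0 ε) (hg0 ε), a * b, X.multClosure.mul_mem ha hb,
    fun ε => mul_pos (ha0 ε) (hb0 ε), hfa.mul hgb⟩

theorem IsMonomialOrder.add (hX : X.StrongAssumption) {f g : X.I → ℝ} (hf : X.IsMonomialOrder f)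
    (hg : X.IsMonomialOrder g) : X.IsMonomialOrder (f + g) := by
  obtain ⟨hf0, a, ha, ha0, hfa⟩ := hf
  obtain ⟨hg0, b, hb, hb0, hgb⟩ := hg
  refine ⟨fun ε => add_pos (hf0 ε) (hg0 ε), ?_⟩
  rcases hX.isBigO_or ha hb ha0 with h | h
  · exact ⟨b, hb, hb0, isTheta_add_of_isBigO (fun ε => (hf0 ε).le) (fun ε => (hg0 ε).le) hgb
      (hfa.1.trans h)⟩
  · refine ⟨a, ha, ha0, ?_⟩
    rw [add_comm]
    exact isTheta_add_of_isBigO (fun ε => (hg0 ε).le) (fun ε => (hf0 ε).le) hfa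
      (hgb.1.trans h.isBigO)

theorem IsMonomialOrder.isBigO_or (hX : X.StrongAssumption) {f g : X.I → ℝ}
    (hf : X.IsMonomialOrder f) (hg : X.IsMonomialOrder g) :
    f =O[towardsZero X.I] g ∨ g =o[towardsZero X.I] f := by
  obtain ⟨-, a, ha, ha0, hfa⟩ := hf
  obtain ⟨-, b, hb, -, hgb⟩ := hg
  rcases hX.isBigO_or ha hb ha0 with h | h
  · exact Or.inl ((hfa.1.trans h).trans hgb.2)
  · exact Or.inr ((hgb.1.trans_isLittleO h).trans_isBigO hfa.2)

theorem StrongAssumption.trans_eq_zero_or (hX : X.StrongAssumption) {u v : S} (huv : u ≠ v) :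
    X.trans u v = 0 ∨ X.IsMonomialOrder (X.trans u v) := by
  by_cases h : X.trans u v = 0
  · exact Or.inl h
  · exact Or.inr ⟨hX.1 u v huv h, _, Subsemigroup.subset_closure ⟨u, v, huv, rfl⟩,
      hX.1 u v huv h, isTheta_refl _ _⟩

theorem isBoundedUnder_le {μ : X.I → S → ℝ} (hμ : X.IsStationaryMap μ) (x : S)
    (l : Filter X.I) : IsBoundedUnder (· ≤ ·) l fun ε => μ ε x :=
  isBoundedUnder_of ⟨1, fun ε => by
    rw [← (hμ ε).1.2]
    exact Finset.single_le_sum (fun y _ => (hμ ε).1.1 y) (Finset.mem_univ x)⟩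

theorem isBoundedUnder_ge {μ : X.I → S → ℝ} (hμ : X.IsStationaryMap μ) (x : S)
    (l : Filter X.I) : IsBoundedUnder (· ≥ ·) l fun ε => μ ε x :=
  isBoundedUnder_of ⟨0, fun ε => (hμ ε).1.1 x⟩

theorem not_isStable_and_isFullyVanishing (X : Perturbation S) (x : S) :
    ¬ (X.IsStable x ∧ X.IsFullyVanishing x) := by
  rintro ⟨⟨μ, hμ, hpos⟩, hv⟩
  have := towardsZero_neBot X.zero_limitPoint
  have hle := liminf_le_limsup (isBoundedUnder_le hμ x (towardsZero X.I))
    (isBoundedUnder_ge hμ x (towardsZero X.I))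
  rw [hv μ hμ] at hle
  exact hpos.not_ge hle

/-- A dominant entry of a family of balanced weights on a closed set is stochastically stable. -/
theorem isStable_of_isBigO {C : Finset S} {x : S} (hx : x ∈ C)
    (hC : ∀ u ∈ C, ∀ v ∉ C, X.trans u v = 0) {W : S → X.I → ℝ} (hW : BalancedOn C X.trans W)
    (hnn : ∀ y ε, 0 ≤ W y ε) (hpos : ∀ ε, 0 < W x ε)
    (hO : ∀ y ∈ C, W y =O[towardsZero X.I] W x) : X.IsStable x := by
  have := towardsZero_neBot X.zero_limitPoint
  have hsum : ∀ ε, 0 < ∑ u ∈ C, W u ε := fun ε =>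
    Finset.sum_pos' (fun u _ => hnn u ε) ⟨x, hx, hpos ε⟩
  have hμ : X.IsStationaryMap fun ε y => if y ∈ C then W y ε / ∑ u ∈ C, W u ε else 0 := by
    intro ε
    refine isStationary_of_balancedOn (X.stochastic ε) (fun u hu v hv => congrFun (hC u hu v hv) ε)
      ?_ (fun u => hnn u ε) (hsum ε)
    intro y hy
    simpa [Finset.sum_apply, trans] using congrFun (hW y hy) ε
  refine ⟨_, hμ, ?_⟩
  obtain ⟨b, hb, hbO⟩ := (IsBigO.sum (s := C) hO).exists_pos
  refine (inv_pos.2 hb).trans_le (le_liminf_of_le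
    (isBoundedUnder_le hμ x (towardsZero X.I)).isCoboundedUnder_ge ?_)
  filter_upwards [hbO.bound] with ε hε
  rw [Finset.sum_apply, Real.norm_of_nonneg (hsum ε).le, Real.norm_of_nonneg (hpos ε).le] at hε
  rw [if_pos hx, le_div_iff₀ (hsum ε), inv_mul_le_iff₀ hb]
  exact hε

theorem isFullyVanishing_of_isLittleO {x y : S} {f g : X.I → ℝ} (hg : ∀ ε, 0 < g ε)
    (hfg : f =o[towardsZero X.I] g)
    (hν : ∀ ν, X.IsStationaryMap ν → ∀ ε, ν ε x * g ε = ν ε y * f ε) :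
    X.IsFullyVanishing x := by
  intro ν hstat
  have := towardsZero_neBot X.zero_limitPoint
  refine Tendsto.limsup_eq (squeeze_zero (fun ε => (hstat ε).1.1 x) (fun ε => ?_)
    ((hfg.tendsto_div_nhds_zero).norm.trans (by simp)))
  have hy1 : ν ε y ≤ 1 := by
    rw [← (hstat ε).1.2]
    exact Finset.single_le_sum (fun y _ => (hstat ε).1.1 y) (Finset.mem_univ y)
  have hy0 : 0 ≤ ν ε y := (hstat ε).1.1 y
  rw [eq_div_of_mul_eq (hg ε).ne' (hν ν hstat ε), mul_div_assoc]
  calc ν ε y * (f ε / g ε) ≤ ν ε y * ‖f ε / g ε‖ :=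
        mul_le_mul_of_nonneg_left (le_abs_self _) hy0
    _ ≤ 1 * ‖f ε / g ε‖ := mul_le_mul_of_nonneg_right hy1 (norm_nonneg _)
    _ = ‖f ε / g ε‖ := one_mul _

theorem isStable_or_isFullyVanishing (hX : X.StrongAssumption) (x : S) :
    X.IsStable x ∨ X.IsFullyVanishing x := by
  have := towardsZero_neBot X.zero_limitPoint
  let IsClosedSet : Finset S → Prop := fun U => ∀ u ∈ U, ∀ v ∉ U, X.trans u v = 0
  obtain ⟨C, hxC, hC, hmin⟩ : ∃ C, x ∈ C ∧ IsClosedSet C ∧ ∀ Z, x ∈ Z → IsClosedSet Z → C ⊆ Z := by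
    classical
    refine ⟨Finset.univ.filter fun y => ∀ Z, x ∈ Z → IsClosedSet Z → y ∈ Z, by simp +contextual,
      ?_, ?_⟩
    · intro u hu v hv
      simp only [Finset.mem_filter, Finset.mem_univ, true_and, not_forall] at hu hv
      obtain ⟨Z, hxZ, hZ, hvZ⟩ := hv
      exact hZ u (hu Z hxZ hZ) v hvZ
    · intro Z hxZ hZ y hy
      simp only [Finset.mem_filter, Finset.mem_univ, true_and] at hy
      exact hy Z hxZ hZ
  by_cases hU : ∃ U ⊆ C, U.Nonempty ∧ x ∉ U ∧ IsClosedSet U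
  · obtain ⟨U, hUC, hne, hxU, hU⟩ := hU
    refine Or.inr fun ν hν => ?_
    have hzero : (fun ε => ν ε x) = fun _ => 0 := by
      funext ε
      refine apply_eq_zero_of_closed (X.stochastic ε) (hν ε)
        (fun u hu v hv => congrFun (hU u hu v hv) ε) hne hxU fun Z hxZ hZ => hUC.trans ?_
      -- `Z` is closed for one `ε` only; positivity makes it closed for all.
      refine hmin Z hxZ fun u hu v hv => ?_
      by_contra h
      exact (hX.1 u v (fun h => hv (h ▸ hu)) h ε).ne' (hZ u hu v hv)
    rw [hzero, limsup_const]
  push Not at hU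
  -- An absorbing `x` is treated apart: there may then be no positive transition map to serve as
  -- `a`.
  by_cases hCx : C = {x}
  · refine Or.inl (isStable_of_isBigO hxC hC (W := fun _ _ => 1) ?_ (by simp) (by simp)
      fun _ _ => isBigO_refl _ _)
    subst hCx
    simp [BalancedOn]
  have hins : insert x (C.erase x) = C := Finset.insert_erase hxC
  have hexit : ∀ U ⊆ C.erase x, U.Nonempty → ∃ u ∈ U, ∃ v ∈ insert x (C.erase x), v ∉ U ∧
      X.IsMonomialOrder (if u = v then 0 else X.trans u v) := by
    intro U hUC hne
    have hnc := hU U (hUC.trans (Finset.erase_subset _ _)) hne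
      fun h => Finset.notMem_erase x C (hUC h)
    simp only [IsClosedSet, not_forall] at hnc
    obtain ⟨u, hu, v, hv, huv⟩ := hnc
    have hne : u ≠ v := fun h => hv (h ▸ hu)
    refine ⟨u, hu, v, ?_, hv, ?_⟩
    · rw [hins]
      by_contra hvC
      exact huv (hC u (Finset.mem_of_mem_erase (hUC hu)) v hvC)
    · rw [if_neg hne]
      exact (hX.trans_eq_zero_or hne).resolve_left huv
  obtain ⟨a, ha⟩ : ∃ a, X.IsMonomialOrder a := by
    have hne : (C.erase x).Nonempty := by
      rw [Finset.nonempty_iff_ne_empty, Ne, Finset.erase_eq_empty_iff, not_or]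
      exact ⟨fun h => by simp [h] at hxC, hCx⟩
    obtain ⟨u, -, v, -, -, h⟩ := hexit _ subset_rfl hne
    exact ⟨_, h⟩
  -- The diagonal is set to zero because the assumptions concern off-diagonal maps only; balance is
  -- unaffected.
  obtain ⟨W, hWbal, hWx, hW, hprop⟩ := exists_balancedOn (P := X.IsMonomialOrder)
    (fun f g hf hg => hf.add hX hg) (fun f g hf hg => hf.mul hg) ha x (C.erase x)
    (Finset.notMem_erase x C) (fun u v => if u = v then 0 else X.trans u v)
    (fun u v => by
      split_ifs with h
      · exact Or.inl rfl
      · exact hX.trans_eq_zero_or h) hexit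
  simp only [hins, balancedOn_offDiag] at hWbal hprop
  by_cases hO : ∀ y ∈ C, W y =O[towardsZero X.I] W x
  · refine Or.inl (isStable_of_isBigO hxC hC hWbal (fun y ε => ?_) hWx.1 hO)
    rcases hW y with h | h
    · simp [h]
    · exact (h.1 ε).le
  · push Not at hO
    obtain ⟨y, hyC, hy⟩ := hO
    have hWy : X.IsMonomialOrder (W y) :=
      (hW y).resolve_left fun h => hy (h ▸ isBigO_zero _ _)
    refine Or.inr (isFullyVanishing_of_isLittleO (y := y) hWy.1
      ((hWy.isBigO_or hX hWx).resolve_left hy) fun ν hν ε => ?_)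
    have hbal : BalancedOn C X.trans fun u ε => ν ε u := by
      intro v hv
      funext ε
      simpa [Finset.sum_apply, trans] using balancedOn_of_isStationary (X.stochastic ε) (hν ε)
        (fun u hu v hv => congrFun (hC u hu v hv) ε) v hv
    exact congrFun (hprop _ hbal x hxC y hyC) ε

end Perturbation

end Asymptotic

theorem mainTheorem9 {S : Type*} [Fintype S] [DecidableEq S] (X : Perturbation S)
    (hX : X.StrongAssumption) (x : S) :
    (X.IsStable x ∨ X.IsFullyVanishing x) ∧ ¬ (X.IsStable x ∧ X.IsFullyVanishing x) :=
  ⟨Perturbation.isStable_or_isFullyVanishing hX x,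
    Perturbation.not_isStable_and_isFullyVanishing X x⟩
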